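/- Let $n\ge 2$, let $\mathbb{B}^n$ be the open unit ball of $\mathbb{R}^n$ (with the Euclidean norm $|\cdot|$), and for $x\in\mathbb{B}^n$ let $d(x)$ be the Euclidean distance from $x$ to $\partial\mathbb{B}^n$. A majorant is a continuous increasing (not necessarily strictly) function $\omega:[0,\infty)\to[0,\infty)$ with $\omega(0)=0$ such that $\omega(t)/t$ is non-increasing for $t>0$. Let $f:\mathbb{B}^n\to\mathbb{R}$ be a $\mathcal{C}^1$ harmonic function and let $\omega$ be a majorant. Then the following are equivalent: (a) there is a constant $C>0$ such that, for all $x\in\mathbb{B}^n$, $$|\nabla f(x)|\le C\,\omega\!\left(\frac{1}{d(x)}\right);$$ (b) there is a constant $C>0$ such that, for all $x,y\in\mathbb{B}^n$ with $x\ne y$, $$\frac{|f(x)-f(y)|}{|x-y|}\le C\,\omega\!\left(\frac{1}{\sqrt{d(x)d(y)}}\right);$$ (c) there is a constant $C>0$ such that, for all $x\in\mathbb{B}^n$ and all $r\in(0,d(x)]$, $f$ is integrable over the ball $\mathbb{B}^n(x,r)=\{\zeta\in\mathbb{R}^n:|\zeta-x|<r\}$ and $$\frac{1}{|\mathbb{B}^n(x,r)|}\int_{\mathbb{B}^n(x,r)}|f(\zeta)-f(x)|\,dV(\zeta)\le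 C\,r\,\omega\!\left(\frac1r\right),$$ where $dV$ is Lebesgue measure and $|\mathbb{B}^n(x,r)|$ the volume of the ball. The constants $C$ in (a), (b), (c) are independent of $x$, $y$, $r$ and may differ from one condition to another. -/

import Mathlib

open MeasureTheory

/-- A majorant: a continuous increasing function `ω : [0, ∞) → [0, ∞)` with `ω 0 = 0` such that
`ω t / t` is non-increasing for `t > 0`. Only the restriction of `ω` to `[0, ∞)` matters. -/
structure IsMajorant (ω : ℝ → ℝ) : Prop where
  nonneg : ∀ t, 0 ≤ t → 0 ≤ ω t
  continuousOn : ContinuousOn ω (Set.Ici 0)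
  monotoneOn : MonotoneOn ω (Set.Ici 0)
  map_zero : ω 0 = 0
  antitoneOn_div : AntitoneOn (fun t => ω t / t) (Set.Ioi 0)

/-- The open unit ball of `ℝⁿ`. -/
abbrev unitBall (n : ℕ) : Set (EuclideanSpace ℝ (Fin n)) := Metric.ball 0 1

/-- The Euclidean distance from `x` to the boundary of the unit ball. -/
noncomputable def bdryDist {n : ℕ} (x : EuclideanSpace ℝ (Fin n)) : ℝ :=
  Metric.infDist x (frontier (unitBall n))

open Topology InnerProductSpace

/-! ### Differentiation under the integral sign -/

section ParametricIntegral

variable {E : Type*} [NormedAddCommGroup E] [MeasurableSpace E] [BorelSpace E]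
  {μ : Measure E} [IsFiniteMeasureOnCompacts μ]

/-! Only (c) ⇒ (a) uses harmonicity. The other two steps rest on `IsMajorant.le_mul`: shrinking the
distance by a factor `q ≤ 1` costs at most `1 / q` in `ω (1 / d)`.

(a) ⇒ (b): on the segment from `x` to `y`, concavity of `1 - ‖·‖` and AM-GM give `d ≥ (1 - t) d(x) +
t d(y) ≥ q √(d(x) d(y))` with `q = 2 √(t (1 - t))`. So the gradient is at most `C ω (1 / √(d(x)
d(y))) / q`, and `1 / q` is integrable on `(0, 1)`.

(b) ⇒ (c): for `ζ = x + r z` one has `d(x) ≥ r` and `d(ζ) ≥ r (1 - ‖z‖)`, so `|f ζ - f x|` is at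
most `C r ω (1 / r) / √(1 - ‖z‖)`, which is integrable over the unit ball.

(c) ⇒ (a): a harmonic function equals its averages against a smooth radial weight. Differentiating
this identity and moving the derivative onto the weight bounds the gradient by the mean oscillation
over `r`; take `r = d(x)`. -/

theorem hasDerivAt_integral_mul_of_hasCompactSupport {G G' : ℝ → E → ℝ}
    (hG : Continuous (Function.uncurry G)) (hG' : Continuous (Function.uncurry G'))
    (h : ∀ s z, HasDerivAt (fun s => G s z) (G' s z) s) {φ : E → ℝ} (hφ : Continuous φ)
    (hφc : HasCompactSupport φ) (s₀ : ℝ) :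
    HasDerivAt (fun s => ∫ z, G s z * φ z ∂μ) (∫ z, G' s₀ z * φ z ∂μ) s₀ := by
  have hc : ∀ s, Continuous (fun z => G s z * φ z) := fun s =>
    (hG.comp (by fun_prop : Continuous fun z : E => (s, z))).mul hφ
  have hc' : ∀ s, Continuous (fun z => G' s z * φ z) := fun s =>
    (hG'.comp (by fun_prop : Continuous fun z : E => (s, z))).mul hφ
  obtain ⟨M, hM⟩ := ((isCompact_closedBall s₀ 1).prod hφc.isCompact).exists_bound_of_continuousOn
    hG'.continuousOn
  have hsm : ∀ {F : E → ℝ}, Continuous F → HasCompactSupport F → AEStronglyMeasurable F μ :=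
    fun h1 h2 => (h1.integrable_of_hasCompactSupport h2).aestronglyMeasurable
  refine (hasDerivAt_integral_of_dominated_loc_of_deriv_le (bound := fun z => M * ‖φ z‖)
    (F' := fun s z => G' s z * φ z)
    (Metric.closedBall_mem_nhds s₀ one_pos) (Filter.Eventually.of_forall fun s =>
      hsm (hc s) hφc.mul_left)
    ((hc s₀).integrable_of_hasCompactSupport hφc.mul_left)
    (hsm (hc' s₀) hφc.mul_left) ?_ ?_ ?_).2
  · refine Filter.Eventually.of_forall fun z s hs => ?_
    by_cases hz : z ∈ tsupport φ
    · rw [norm_mul]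
      exact mul_le_mul_of_nonneg_right (hM (s, z) ⟨hs, hz⟩) (norm_nonneg _)
    · simp [image_eq_zero_of_notMem_tsupport hz]
  · exact ((continuous_const.mul hφ.norm).integrable_of_hasCompactSupport hφc.norm.mul_left)
  · exact Filter.Eventually.of_forall fun z s _ => (h s z).mul_const _

end ParametricIntegral

theorem hasCompactSupport_of_norm_lt {E : Type*} [NormedAddCommGroup E] [ProperSpace E]
    {φ : E → ℝ} {r : ℝ} (h : ∀ z, φ z ≠ 0 → ‖z‖ < r) :
    HasCompactSupport φ :=
  HasCompactSupport.intro (isCompact_closedBall (0 : E) r) fun z hz => by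
    by_contra h0
    exact hz (mem_closedBall_zero_iff.2 (h z h0).le)

theorem fderiv_comp_add_smul_apply {E : Type*} [NormedAddCommGroup E] [NormedSpace ℝ E]
    (g : E → ℝ) (x : E) (t : ℝ) (z v : E) (hg : Differentiable ℝ g) :
    fderiv ℝ (fun z => g (x + t • z)) z v = t * fderiv ℝ g (x + t • z) v := by
  have h1 : HasFDerivAt (fun z : E => x + t • z) (t • ContinuousLinearMap.id ℝ E) z :=
    ((hasFDerivAt_id z).const_smul t).const_add x
  have h2 : HasFDerivAt (fun z => g (x + t • z)) _ z :=
    HasFDerivAt.comp z (hg (x + t • z)).hasFDerivAt h1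
  rw [h2.fderiv]
  simp

/-! ### Weighted mean value property -/

section MeanValue

variable {E : Type*} [NormedAddCommGroup E] [InnerProductSpace ℝ E] [FiniteDimensional ℝ E]
  [MeasurableSpace E] [BorelSpace E]

/-- Integration by parts against a compactly supported `C¹` function. -/
theorem integral_fderiv_mul_eq_neg_of_hasCompactSupport {u Φ : E → ℝ} (hu : ContDiff ℝ 1 u)
    (hΦ : ContDiff ℝ 1 Φ) (hΦc : HasCompactSupport Φ) (v : E) :
    ∫ z, u z * fderiv ℝ Φ z v = - ∫ z, fderiv ℝ u z v * Φ z := by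
  have hu' := hu.continuous_fderiv one_ne_zero
  have hΦ' := hΦ.continuous_fderiv one_ne_zero
  apply integral_mul_fderiv_eq_neg_fderiv_mul_of_integrable
  · exact ((hu'.clm_apply continuous_const).mul hΦ.continuous).integrable_of_hasCompactSupport
      hΦc.mul_left
  · exact (hu.continuous.mul (hΦ'.clm_apply continuous_const)).integrable_of_hasCompactSupport
      (hΦc.fderiv_apply ℝ v).mul_left
  · exact (hu.continuous.mul hΦ.continuous).integrable_of_hasCompactSupport hΦc.mul_left
  · exact fun x _ => (hu.differentiable one_ne_zero) x
  · exact fun x _ => (hΦ.differentiable one_ne_zero) x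

/-- A radial weight: `Φ` is supported in the ball of radius `1 / 2` and its gradient is
`z ↦ φ z • z`. -/
structure IsRadialWeight (Φ φ : E → ℝ) : Prop where
  contDiff_potential : ContDiff ℝ 1 Φ
  contDiff : ContDiff ℝ 1 φ
  norm_lt : ∀ z, Φ z ≠ 0 → ‖z‖ < 1 / 2
  norm_lt' : ∀ z, φ z ≠ 0 → ‖z‖ < 1 / 2
  fderiv_apply : ∀ z v, fderiv ℝ Φ z v = φ z * inner ℝ z v
  integral_ne_zero : ∫ z, φ z ≠ 0

/-- Compose a smooth one-sided cutoff with `1 / 4 - ‖z‖ ^ 2`. Since `φ ≤ 0`, a zero integral would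
force `φ = 0` and hence `Φ` constant, yet `Φ` is positive at `0` and vanishes at unit vectors. -/
theorem exists_isRadialWeight [Nontrivial E] : ∃ Φ φ : E → ℝ, IsRadialWeight Φ φ := by
  have hexp : ContDiff ℝ 2 expNegInvGlue := expNegInvGlue.contDiff (n := 2)
  have hd : ContDiff ℝ 1 (deriv expNegInvGlue) := by
    have : ContDiff ℝ (1 + 1) expNegInvGlue := by convert hexp; norm_num
    exact (contDiff_succ_iff_deriv.1 this).2.2
  let Φ : E → ℝ := fun z => expNegInvGlue (1 / 4 - ‖z‖ ^ 2)
  let φ : E → ℝ := fun z => -2 * deriv expNegInvGlue (1 / 4 - ‖z‖ ^ 2)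
  have hΦ : ContDiff ℝ 1 Φ :=
    (hexp.of_le (by norm_num)).comp (contDiff_const.sub (contDiff_norm_sq ℝ))
  have hφ : ContDiff ℝ 1 φ :=
    contDiff_const.mul (hd.comp (contDiff_const.sub (contDiff_norm_sq ℝ)))
  have hneg : ∀ z : E, 1 / 4 - ‖z‖ ^ 2 > 0 → ‖z‖ < 1 / 2 := fun z hz => by
    nlinarith [norm_nonneg z]
  have hΦs : ∀ z, Φ z ≠ 0 → ‖z‖ < 1 / 2 := fun z hz => hneg z (by
    by_contra h0
    exact hz (expNegInvGlue.zero_of_nonpos (not_lt.1 h0)))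
  have hder : ∀ s ≤ 0, deriv expNegInvGlue s = 0 := by
    intro s hs
    have := expNegInvGlue.hasDerivAt_polynomial_eval_inv_mul 1 s
    simp only [Polynomial.eval_one, one_mul, expNegInvGlue.zero_of_nonpos hs, mul_zero] at this
    exact this.deriv
  have hφs : ∀ z, φ z ≠ 0 → ‖z‖ < 1 / 2 := fun z hz => hneg z (by
    by_contra h0
    exact hz (by simp only [φ, hder _ (not_lt.1 h0), mul_zero]))
  have hfd : ∀ z v, fderiv ℝ Φ z v = φ z * inner ℝ z v := by
    intro z v
    have h1 : HasFDerivAt (fun z : E => 1 / 4 - ‖z‖ ^ 2) (-(2 • innerSL ℝ z)) z :=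
      ((hasStrictFDerivAt_norm_sq z).hasFDerivAt).const_sub _
    have h2 := ((hexp.differentiable (by norm_num)) (1 / 4 - ‖z‖ ^ 2)).hasDerivAt.comp_hasFDerivAt
      z h1
    rw [show fderiv ℝ Φ z = _ from h2.fderiv]
    simp [φ]
    ring
  refine ⟨Φ, φ, hΦ, hφ, hΦs, hφs, hfd, fun h0 => ?_⟩
  have hnonneg : ∀ z, 0 ≤ -φ z := fun z => by
    have : 0 ≤ deriv expNegInvGlue (1 / 4 - ‖z‖ ^ 2) := expNegInvGlue.monotone.deriv_nonneg
    simp only [φ]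
    linarith
  have hz : ∀ z, φ z = 0 := by
    have h1 := (integral_eq_zero_iff_of_nonneg (μ := volume) (f := fun z => -φ z) hnonneg
      (hφ.continuous.integrable_of_hasCompactSupport
        (hasCompactSupport_of_norm_lt hφs)).neg).1 (by rw [integral_neg, h0, neg_zero])
    have h2 := Continuous.ae_eq_iff_eq volume hφ.continuous.neg continuous_zero |>.1 h1
    intro z
    simpa using congrFun h2 z
  have hconst := is_const_of_fderiv_eq_zero (hΦ.differentiable one_ne_zero) fun z => by
    ext v; simp [hfd, hz]
  obtain ⟨w, hw⟩ := exists_norm_eq E zero_le_one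
  have h1 := hconst 0 w
  simp only [Φ, hw, norm_zero] at h1
  rw [expNegInvGlue.zero_of_nonpos (by norm_num : (1 / 4 - 1 ^ 2 : ℝ) ≤ 0)] at h1
  exact (expNegInvGlue.pos_of_pos (by norm_num)).ne' h1

/-- The weighted mean value property of harmonic functions. -/
theorem IsRadialWeight.integral_eq {Φ φ : E → ℝ} (hw : IsRadialWeight Φ φ) {g : E → ℝ}
    (hg : ContDiff ℝ 2 g) {x : E} {r : ℝ} (hr : 0 ≤ r)
    (hΔ : ∀ y ∈ Metric.ball x (r / 2), Laplacian.laplacian g y = 0) :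
    ∫ z, g (x + r • z) * φ z = g x * ∫ z, φ z := by
  have hgd := hg.differentiable two_ne_zero
  have hg' : ContDiff ℝ 1 (fderiv ℝ g) := hg.fderiv_right (by norm_num)
  have hφc := hasCompactSupport_of_norm_lt hw.norm_lt'
  have hΦc := hasCompactSupport_of_norm_lt hw.norm_lt
  have hder : ∀ t : ℝ, HasDerivAt (fun t : ℝ => ∫ z, g (x + t • z) * φ z)
      (∫ z, fderiv ℝ g (x + t • z) z * φ z) t := by
    intro t
    refine hasDerivAt_integral_mul_of_hasCompactSupport (G := fun t z => g (x + t • z))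
      (G' := fun t z => fderiv ℝ g (x + t • z) z) ?_ ?_ ?_ hw.contDiff.continuous hφc t
    · exact hg.continuous.comp (by fun_prop)
    · exact (hg'.continuous.comp (by fun_prop)).clm_apply (by fun_prop)
    · intro s z
      have h1 : HasDerivAt (fun s : ℝ => x + s • z) z s := by
        simpa using ((hasDerivAt_id s).smul_const z).const_add x
      exact (hgd (x + s • z)).hasFDerivAt.comp_hasDerivAt s h1
  -- As `φ z • z` is the gradient of `Φ`, integrating by parts turns this into `-t ∫ Δg (x + t z) Φ
  -- z`.
  have hzero : ∀ t : ℝ, 0 ≤ t → t ≤ r → ∫ z, fderiv ℝ g (x + t • z) z * φ z = 0 := by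
    intro t ht htr
    let b := stdOrthonormalBasis ℝ E
    have hb : ∀ i, ContDiff ℝ 1 (fun y => fderiv ℝ g y (b i)) := fun i =>
      hg'.clm_apply contDiff_const
    have hbt : ∀ i, ContDiff ℝ 1 (fun z => fderiv ℝ g (x + t • z) (b i)) := fun i =>
      (hb i).comp (contDiff_const.add (contDiff_id.const_smul t))
    have hΦ' := hw.contDiff_potential.continuous_fderiv one_ne_zero
    have h1 : ∀ z, fderiv ℝ g (x + t • z) z * φ z
        = ∑ i, fderiv ℝ g (x + t • z) (b i) * fderiv ℝ Φ z (b i) := by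
      intro z
      conv_lhs => rw [← b.sum_repr' z, map_sum]
      rw [b.sum_repr' z, Finset.sum_mul]
      refine Finset.sum_congr rfl fun i _ => ?_
      rw [hw.fderiv_apply, map_smul, smul_eq_mul, real_inner_comm]
      ring
    simp_rw [h1]
    rw [integral_finsetSum]
    · have h2 : ∀ i, ∫ z, fderiv ℝ g (x + t • z) (b i) * fderiv ℝ Φ z (b i)
          = - ∫ z, t * iteratedFDeriv ℝ 2 g (x + t • z) ![b i, b i] * Φ z := by
        intro i
        rw [integral_fderiv_mul_eq_neg_of_hasCompactSupport (hbt i) hw.contDiff_potential hΦc]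
        congr 1
        refine integral_congr_ae (Filter.Eventually.of_forall fun z => ?_)
        simp only
        rw [fderiv_comp_add_smul_apply (fun y => fderiv ℝ g y (b i)) x t z (b i)
          ((hb i).differentiable one_ne_zero), iteratedFDeriv_two_apply]
        have := fderiv_clm_apply (𝕜 := ℝ) (c := fderiv ℝ g) (u := fun _ : E => b i) (x := x + t • z)
          (hg'.differentiable one_ne_zero _) (differentiableAt_const _)
        rw [this]
        simp
      have hc2 : Continuous (iteratedFDeriv ℝ 2 g) := hg.continuous_iteratedFDeriv (by norm_num)
      simp_rw [h2]
      rw [Finset.sum_neg_distrib, ← integral_finsetSum]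
      · rw [neg_eq_zero]
        refine integral_eq_zero_of_ae (Filter.Eventually.of_forall fun z => ?_)
        simp only [Pi.zero_apply]
        by_cases hz : Φ z = 0
        · simp [hz]
        rw [← Finset.sum_mul, ← Finset.mul_sum]
        -- If `r = 0` the ball in `hΔ` is empty, so `t = 0` is settled by the factor `t`.
        rcases ht.eq_or_lt with rfl | htpos
        · simp
        have := hΔ (x + t • z) (by
          rw [mem_ball_iff_norm, add_sub_cancel_left, norm_smul, Real.norm_of_nonneg ht]
          have := hw.norm_lt z hz
          nlinarith [norm_nonneg z])
        rw [laplacian_eq_iteratedFDeriv_orthonormalBasis g b] at this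
        simp only at this
        rw [this]; simp
      · intro i _
        refine Continuous.integrable_of_hasCompactSupport ?_ hΦc.mul_left
        refine (continuous_const.mul ?_).mul hw.contDiff_potential.continuous
        exact (ContinuousMultilinearMap.apply ℝ (fun _ : Fin 2 => E) ℝ ![b i, b i]).continuous.comp
          (hc2.comp (by fun_prop))
    · intro i _
      exact ((hbt i).continuous.mul
        (hΦ'.clm_apply continuous_const)).integrable_of_hasCompactSupport
        (hΦc.fderiv_apply ℝ (b i)).mul_left
  have := constant_of_has_deriv_right_zero (a := 0) (b := r)
    (f := fun t : ℝ => ∫ z, g (x + t • z) * φ z)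
    (fun t _ => (hder t).continuousAt.continuousWithinAt)
    (fun t ht => by
      have := hder t
      rw [hzero t ht.1 ht.2.le] at this
      exact this.hasDerivWithinAt) r ⟨hr, le_rfl⟩
  simp only [zero_smul, add_zero] at this
  rw [this, integral_const_mul]

end MeanValue

/-! ### Rescaling ball averages to the unit ball -/

section Average

variable {E : Type*} [NormedAddCommGroup E] [NormedSpace ℝ E] [FiniteDimensional ℝ E]
  [MeasurableSpace E] [BorelSpace E]

theorem indicator_ball_comp_add_smul {E : Type*} [NormedAddCommGroup E] [NormedSpace ℝ E] (F : E → ℝ) (x : E) {r : ℝ} (hr : 0 < r) (z : E) :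
    (Metric.ball x r).indicator F (x + r • z)
      = (Metric.ball (0 : E) 1).indicator (fun z => F (x + r • z)) z := by
  have : x + r • z ∈ Metric.ball x r ↔ z ∈ Metric.ball (0 : E) 1 := by
    rw [mem_ball_iff_norm, add_sub_cancel_left, norm_smul, Real.norm_of_nonneg hr.le,
      mem_ball_zero_iff, mul_lt_iff_lt_one_right hr]
  by_cases h : z ∈ Metric.ball (0 : E) 1
  · rw [Set.indicator_of_mem h, Set.indicator_of_mem (this.2 h)]
  · rw [Set.indicator_of_notMem h, Set.indicator_of_notMem (fun h' => h (this.1 h'))]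

theorem integrableOn_ball_iff_comp_add_smul {μ : Measure E} [μ.IsAddHaarMeasure]
    (F : E → ℝ) (x : E) {r : ℝ} (hr : 0 < r) :
    IntegrableOn F (Metric.ball x r) μ ↔
      IntegrableOn (fun z => F (x + r • z)) (Metric.ball 0 1) μ := by
  rw [← integrable_indicator_iff Metric.isOpen_ball.measurableSet,
    ← integrable_indicator_iff Metric.isOpen_ball.measurableSet]
  simp_rw [← funext fun z => indicator_ball_comp_add_smul F x hr z]
  rw [integrable_comp_smul_iff μ (fun y => (Metric.ball x r).indicator F (x + y)) hr.ne']
  constructor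
  · exact fun h => h.comp_add_left x
  · intro h
    simpa using h.comp_add_left (-x)

theorem average_ball_eq {μ : Measure E} [μ.IsAddHaarMeasure]
    (F : E → ℝ) (x : E) {r : ℝ} (hr : 0 < r) :
    1 / μ.real (Metric.ball x r) * ∫ ζ in Metric.ball x r, F ζ ∂μ =
      1 / μ.real (Metric.ball (0 : E) 1) * ∫ z in Metric.ball 0 1, F (x + r • z) ∂μ := by
  rw [← integral_indicator Metric.isOpen_ball.measurableSet,
    ← integral_indicator Metric.isOpen_ball.measurableSet]
  simp_rw [← funext fun z => indicator_ball_comp_add_smul F x hr z]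
  rw [Measure.integral_comp_smul_of_nonneg μ (fun y => (Metric.ball x r).indicator F (x + y)) r
    (hR := hr.le), integral_add_left_eq_self, measureReal_def, Measure.addHaar_ball_of_pos μ x hr,
    ENNReal.toReal_mul, ENNReal.toReal_ofReal (by positivity), smul_eq_mul, measureReal_def]
  field_simp

end Average

/-! ### Gradient bound by mean oscillation -/

section GradientEstimate

variable {E : Type*} [NormedAddCommGroup E] [InnerProductSpace ℝ E] [FiniteDimensional ℝ E]
  [MeasurableSpace E] [BorelSpace E]

/-- Multiplying by a bump function supplies the global smoothness needed by the integral identities,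
without changing the function near the centre. -/
theorem exists_contDiff_eqOn_ball {E : Type*} [NormedAddCommGroup E] [InnerProductSpace ℝ E]
    [FiniteDimensional ℝ E] {f : E → ℝ} {x : E} {r s : ℝ} (hs : 0 < s) (hsr : s < r)
    (hf : ContDiffOn ℝ 2 f (Metric.ball x r)) :
    ∃ g : E → ℝ, ContDiff ℝ 2 g ∧ Set.EqOn g f (Metric.ball x s) := by
  let χ : ContDiffBump x := ⟨s, (s + r) / 2, hs, by linarith⟩
  refine ⟨fun y => χ y * f y, ?_, fun y hy => ?_⟩
  · rw [contDiff_iff_contDiffAt]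
    intro y
    by_cases hy : y ∈ Metric.ball x r
    · exact χ.contDiff.contDiffAt.mul (hf.contDiffAt (Metric.isOpen_ball.mem_nhds hy))
    · have hy' : y ∉ tsupport χ := by
        rw [χ.tsupport_eq]
        intro h
        refine hy (Metric.mem_ball.2 ((Metric.mem_closedBall.1 h).trans_lt ?_))
        change (s + r) / 2 < r
        linarith
      refine (contDiffAt_const (c := (0 : ℝ))).congr_of_eventuallyEq ?_
      filter_upwards [notMem_tsupport_iff_eventuallyEq.1 hy'] with z hz
      rw [hz]; simp
  · simp only [χ.one_of_mem_closedBall (Metric.ball_subset_closedBall hy), one_mul]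

/-- The gradient of a harmonic function at the centre of a ball is controlled by its mean
oscillation over the ball. -/
theorem exists_norm_fderiv_le_mean_oscillation [Nontrivial E] :
    ∃ K : ℝ, 0 < K ∧ ∀ (f : E → ℝ) (x : E) (r : ℝ), 0 < r →
      HarmonicOnNhd f (Metric.ball x r) →
      IntegrableOn (fun ζ => |f ζ - f x|) (Metric.ball x r) volume →
      ‖fderiv ℝ f x‖ ≤ K / r *
        (1 / volume.real (Metric.ball x r) * ∫ ζ in Metric.ball x r, |f ζ - f x|) := by
  obtain ⟨Φ, φ, hw⟩ := exists_isRadialWeight (E := E)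
  have hφc := hasCompactSupport_of_norm_lt hw.norm_lt'
  have hφ' := hw.contDiff.continuous_fderiv one_ne_zero
  obtain ⟨M, hM⟩ := hφ'.bounded_above_of_compact_support (hφc.fderiv ℝ)
  have hM0 : 0 ≤ M := (norm_nonneg _).trans (hM 0)
  set c := ∫ z, φ z with hc
  have hc0 : 0 < |c| := abs_pos.2 hw.integral_ne_zero
  set V := volume.real (Metric.ball (0 : E) 1) with hV
  have hV0 : 0 < V := 
    ENNReal.toReal_pos (Metric.measure_ball_pos volume 0 one_pos).ne' measure_ball_lt_top.ne
  refine ⟨(M + 1) * V / |c|, by positivity, fun f x r hr hf hint => ?_⟩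
  obtain ⟨g, hg, hgf⟩ := exists_contDiff_eqOn_ball (s := 3 * r / 4) (by linarith) (by linarith)
    hf.contDiffOn
  have hgd := hg.differentiable two_ne_zero
  have hg' : ContDiff ℝ 1 (fderiv ℝ g) := hg.fderiv_right (by norm_num)
  have hev : ∀ y ∈ Metric.ball x (3 * r / 4), g =ᶠ[𝓝 y] f := fun y hy =>
    Filter.eventuallyEq_of_mem (Metric.isOpen_ball.mem_nhds hy) hgf
  have hx : x ∈ Metric.ball x (3 * r / 4) := Metric.mem_ball_self (by linarith)
  have hΔ : ∀ y ∈ Metric.ball x (3 * r / 4), Laplacian.laplacian g y = 0 := fun y hy => by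
    rw [(laplacian_congr_nhds (hev y hy)).eq_of_nhds]
    exact (hf y (Metric.ball_subset_ball (by linarith) hy)).2.eq_of_nhds
  -- The weight reaches `r / 2` from `y`, and `r / 4 + r / 2 = 3 * r / 4` stays where `g = f`. A
  -- neighbourhood of `x` is needed in order to differentiate.
  have hmv : ∀ y ∈ Metric.ball x (r / 4), ∫ z, g (y + r • z) * φ z = g y * c := fun y hy =>
    hw.integral_eq hg hr.le fun w hw => hΔ w (by
      rw [Metric.mem_ball] at *
      linarith [dist_triangle w y x])
  rw [average_ball_eq _ x hr, ← (hev x hx).fderiv_eq]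
  rw [integrableOn_ball_iff_comp_add_smul _ x hr] at hint
  set I := ∫ z in Metric.ball (0 : E) 1, |f (x + r • z) - f x| with hI
  refine ContinuousLinearMap.opNorm_le_bound _ (by positivity) fun v => ?_
  have hsmooth : ContDiff ℝ 1 (fun z => g (x + r • z)) :=
    (hg.of_le (by norm_num)).comp (contDiff_const.add (contDiff_id.const_smul r))
  have h1 : HasDerivAt (fun s : ℝ => ∫ z, g (x + s • v + r • z) * φ z)
      (∫ z, fderiv ℝ g (x + (0 : ℝ) • v + r • z) v * φ z) 0 := by
    refine hasDerivAt_integral_mul_of_hasCompactSupport (G := fun s z => g (x + s • v + r • z))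
      (G' := fun s z => fderiv ℝ g (x + s • v + r • z) v) ?_ ?_ ?_ hw.contDiff.continuous hφc 0
    · exact hg.continuous.comp (by fun_prop)
    · exact (hg'.continuous.comp (by fun_prop)).clm_apply (by fun_prop)
    · intro s z
      have h1 : HasDerivAt (fun s : ℝ => x + s • v + r • z) v s := by
        simpa using (((hasDerivAt_id s).smul_const v).const_add x).add_const (r • z)
      exact (hgd _).hasFDerivAt.comp_hasDerivAt s h1
  have hline : HasDerivAt (fun s : ℝ => x + s • v) v 0 := by
    simpa using ((hasDerivAt_id (0 : ℝ)).smul_const v).const_add x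
  have h2 : HasDerivAt (fun s : ℝ => g (x + s • v) * c) (fderiv ℝ g x v * c) 0 := by
    refine HasDerivAt.mul_const ?_ c
    have := (hgd (x + (0 : ℝ) • v)).hasFDerivAt.comp_hasDerivAt 0 hline
    simpa [Function.comp_def] using this
  have h3 : (fun s : ℝ => ∫ z, g (x + s • v + r • z) * φ z)
      =ᶠ[𝓝 0] fun s : ℝ => g (x + s • v) * c := by
    have := hline.continuousAt.eventually_mem
      (s := Metric.ball x (r / 4)) (by simpa using Metric.ball_mem_nhds x (by linarith))
    filter_upwards [this] with s hs using hmv _ hs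
  have h4 : fderiv ℝ g x v * c = ∫ z, fderiv ℝ g (x + r • z) v * φ z := by
    have := (h2.congr_of_eventuallyEq h3).unique h1
    simpa using this
  -- Subtracting the constant `g x` does not change the derivative, and it makes the oscillation
  -- appear.
  have h5 : r * (fderiv ℝ g x v * c) = - ∫ z, (g (x + r • z) - g x) * fderiv ℝ φ z v := by
    rw [h4, integral_fderiv_mul_eq_neg_of_hasCompactSupport (hsmooth.sub contDiff_const)
      hw.contDiff hφc v, neg_neg, ← integral_const_mul]
    refine integral_congr_ae (Filter.Eventually.of_forall fun z => ?_)
    simp only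
    rw [fderiv_sub_const, fderiv_comp_add_smul_apply g x r z v hgd]
    ring
  have h6 : |∫ z, (g (x + r • z) - g x) * fderiv ℝ φ z v| ≤ M * ‖v‖ * I := by
    rw [hI, ← integral_const_mul, ← integral_indicator Metric.isOpen_ball.measurableSet,
      ← Real.norm_eq_abs]
    refine norm_integral_le_of_norm_le ?_ (Filter.Eventually.of_forall fun z => ?_)
    · rw [integrable_indicator_iff Metric.isOpen_ball.measurableSet]
      exact hint.const_mul _
    by_cases hz : z ∈ tsupport φ
    · have hz' : ‖z‖ ≤ 1 / 2 := by
        have : tsupport φ ⊆ Metric.closedBall 0 (1 / 2) :=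
          closure_minimal (fun w hw' => mem_closedBall_zero_iff.2 (hw.norm_lt' w hw').le)
            Metric.isClosed_closedBall
        exact mem_closedBall_zero_iff.1 (this hz)
      rw [Set.indicator_of_mem (mem_ball_zero_iff.2 (by linarith)), norm_mul, Real.norm_eq_abs,
        hgf hx, hgf (x := x + r • z) (by
          rw [mem_ball_iff_norm, add_sub_cancel_left, norm_smul, Real.norm_of_nonneg hr.le]
          nlinarith), mul_comm]
      exact mul_le_mul_of_nonneg_right ((fderiv ℝ φ z).le_of_opNorm_le (hM z) v) (abs_nonneg _)
    · have : fderiv ℝ φ z = 0 := by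
        by_contra h
        exact hz (support_fderiv_subset ℝ h)
      rw [this]
      simp only [zero_apply, mul_zero, norm_zero]
      exact Set.indicator_nonneg (fun z _ => by positivity) z
  have hI0 : 0 ≤ I := integral_nonneg fun z => abs_nonneg _
  have h7 : r * (|fderiv ℝ g x v| * |c|) ≤ M * ‖v‖ * I := by
    rwa [← abs_neg, ← h5, abs_mul, abs_mul, abs_of_pos hr] at h6
  rw [Real.norm_eq_abs]
  have h8 : (M + 1) * V / |c| / r * (1 / V * I) * ‖v‖ = ((M + 1) * ‖v‖ * I) / (r * |c|) := by
    field_simp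
  rw [h8, le_div_iff₀ (by positivity)]
  nlinarith [mul_nonneg (norm_nonneg v) hI0]

end GradientEstimate

/-! ### Boundary distance, majorants and oscillation -/

theorem bdryDist_eq_one_sub_norm {n : ℕ} (hn : n ≠ 0) {x : EuclideanSpace ℝ (Fin n)}
    (hx : x ∈ unitBall n) : bdryDist x = 1 - ‖x‖ := by
  have : NeZero n := ⟨hn⟩
  have hx1 : ‖x‖ < 1 := mem_ball_zero_iff.1 hx
  rw [bdryDist, frontier_ball (0 : EuclideanSpace ℝ (Fin n)) one_ne_zero]
  have hray : ∃ y ∈ Metric.sphere (0 : EuclideanSpace ℝ (Fin n)) 1, dist x y = 1 - ‖x‖ := by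
    rcases eq_or_ne x 0 with rfl | hx0
    · obtain ⟨y, hy⟩ := exists_norm_eq (EuclideanSpace ℝ (Fin n)) zero_le_one
      exact ⟨y, mem_sphere_zero_iff_norm.2 hy, by simp [hy]⟩
    · have hpos := norm_pos_iff.2 hx0
      refine ⟨‖x‖⁻¹ • x, ?_, ?_⟩
      · rw [mem_sphere_zero_iff_norm, norm_smul, norm_inv, norm_norm, inv_mul_cancel₀ hpos.ne']
      · rw [dist_eq_norm', show ‖x‖⁻¹ • x - x = (‖x‖⁻¹ - 1) • x by rw [sub_smul, one_smul],
          norm_smul, Real.norm_of_nonneg (sub_nonneg.2 (one_le_inv_iff₀.2 ⟨hpos, hx1.le⟩))]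
        field_simp
  obtain ⟨y, hy, hxy⟩ := hray
  refine le_antisymm (hxy ▸ Metric.infDist_le_dist_of_mem hy) ?_
  refine (Metric.le_infDist ⟨y, hy⟩).2 fun z hz => ?_
  rw [← mem_sphere_zero_iff_norm.1 hz, dist_eq_norm']
  exact norm_sub_norm_le z x

/-- Monotonicity passes from `u` to `l * s`; the decrease of `ω t / t` then pulls out `l`. -/
theorem IsMajorant.le_mul {ω : ℝ → ℝ} (hω : IsMajorant ω) {s u l : ℝ} (hs : 0 < s) (hu : 0 ≤ u)
    (hl : 1 ≤ l) (h : u ≤ l * s) : ω u ≤ l * ω s := by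
  have hls : 0 < l * s := by positivity
  have h1 : ω u ≤ ω (l * s) := hω.monotoneOn hu hls.le h
  have h2 : ω (l * s) / (l * s) ≤ ω s / s :=
    hω.antitoneOn_div (Set.mem_Ioi.2 hs) (Set.mem_Ioi.2 hls) (le_mul_of_one_le_left hs.le hl)
  rw [div_le_div_iff₀ hls hs] at h2
  have h3 : ω (l * s) * s ≤ (l * ω s) * s := by linarith
  exact h1.trans (le_of_mul_le_mul_right h3 hs)

theorem norm_gradient_eq {n : ℕ} (f : EuclideanSpace ℝ (Fin n) → ℝ)
    (x : EuclideanSpace ℝ (Fin n)) : ‖gradient f x‖ = ‖fderiv ℝ f x‖ := by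
  rw [gradient, LinearIsometryEquiv.norm_map]

/-- A gradient bound in terms of `ω (1 / d)` gives a weighted Lipschitz bound. -/
theorem IsMajorant.abs_sub_le_of_norm_fderiv_le {E : Type*} [NormedAddCommGroup E]
    [NormedSpace ℝ E] {ω : ℝ → ℝ} (hω : IsMajorant ω) {f : E → ℝ}
    (hf : DifferentiableOn ℝ f (Metric.ball 0 1)) {C : ℝ} (hC : 0 ≤ C)
    (h : ∀ x ∈ Metric.ball (0 : E) 1, ‖fderiv ℝ f x‖ ≤ C * ω (1 / (1 - ‖x‖)))
    {x y : E} (hx : ‖x‖ < 1) (hy : ‖y‖ < 1) :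
    |f x - f y| ≤ C * Real.pi * ω (1 / √((1 - ‖x‖) * (1 - ‖y‖))) * ‖x - y‖ := by
  set a := 1 - ‖x‖ with ha
  set b := 1 - ‖y‖ with hb
  have ha0 : 0 < a := by linarith
  have hb0 : 0 < b := by linarith
  have hab : 0 < √(a * b) := Real.sqrt_pos.2 (by positivity)
  set W := ω (1 / √(a * b)) with hW
  have hW0 : 0 ≤ W := hω.nonneg _ (by positivity)
  have hγ : ∀ t ∈ Set.Icc (0 : ℝ) 1, (1 - t) * a + t * b ≤ 1 - ‖x + t • (y - x)‖ := by
    intro t ht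
    have : ‖x + t • (y - x)‖ ≤ (1 - t) * ‖x‖ + t * ‖y‖ := by
      rw [show x + t • (y - x) = (1 - t) • x + t • y by module]
      refine (norm_add_le _ _).trans_eq ?_
      rw [norm_smul, norm_smul, Real.norm_of_nonneg ht.1, Real.norm_of_nonneg (sub_nonneg.2 ht.2)]
    rw [ha, hb]
    linarith
  have hγpos : ∀ t ∈ Set.Icc (0 : ℝ) 1, 0 < (1 - t) * a + t * b := by
    intro t ht
    rcases ht.1.eq_or_lt with rfl | h0
    · simpa using ha0
    · have := mul_nonneg (sub_nonneg.2 ht.2) ha0.le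
      have := mul_pos h0 hb0
      linarith
  have hmem : ∀ t ∈ Set.Icc (0 : ℝ) 1, x + t • (y - x) ∈ Metric.ball (0 : E) 1 := by
    intro t ht
    rw [mem_ball_zero_iff]
    linarith [hγ t ht, hγpos t ht]
  have hder : ∀ t ∈ Set.Icc (0 : ℝ) 1, HasDerivAt (fun t : ℝ => f (x + t • (y - x)))
      (fderiv ℝ f (x + t • (y - x)) (y - x)) t := by
    intro t ht
    have h1 : HasDerivAt (fun t : ℝ => x + t • (y - x)) (y - x) t := by
      simpa using ((hasDerivAt_id t).smul_const (y - x)).const_add x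
    exact ((hf _ (hmem t ht)).differentiableAt
      (Metric.isOpen_ball.mem_nhds (hmem t ht))).hasFDerivAt.comp_hasDerivAt t h1
  have harc : ∀ t ∈ Set.Ioo (0 : ℝ) 1, HasDerivAt (fun t : ℝ => Real.arcsin (2 * t - 1))
      (1 / √(1 - (2 * t - 1) ^ 2) * 2) t := by
    intro t ht
    have h1 : HasDerivAt (fun t : ℝ => 2 * t - 1) 2 t := by
      simpa using ((hasDerivAt_id t).const_mul 2).sub_const 1
    exact (Real.hasDerivAt_arcsin (by linarith [ht.1]) (by linarith [ht.2])).comp t h1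
  -- Cauchy's mean value theorem against `arcsin (2 t - 1)`, whose derivative is `2 / q`, replaces
  -- integrating `1 / q`; its total increment is `π`.
  obtain ⟨t, ht, hmvt⟩ := exists_ratio_hasDerivAt_eq_ratio_slope
    (fun t : ℝ => f (x + t • (y - x))) (fun t => fderiv ℝ f (x + t • (y - x)) (y - x))
    (zero_lt_one) (fun t ht => (hder t ht).continuousAt.continuousWithinAt)
    (fun t ht => hder t ⟨ht.1.le, ht.2.le⟩)
    (fun t : ℝ => Real.arcsin (2 * t - 1)) (fun t => 1 / √(1 - (2 * t - 1) ^ 2) * 2)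
    (Real.continuous_arcsin.comp (by fun_prop)).continuousOn harc
  have ht' : t ∈ Set.Icc (0 : ℝ) 1 := ⟨ht.1.le, ht.2.le⟩
  have hq : 0 < 1 - (2 * t - 1) ^ 2 := by nlinarith [mul_pos ht.1 (sub_pos.2 ht.2)]
  set q := √(1 - (2 * t - 1) ^ 2) with hqdef
  have hq0 : 0 < q := Real.sqrt_pos.2 hq
  have hq1 : q ≤ 1 := Real.sqrt_le_one.2 (by nlinarith [sq_nonneg (2 * t - 1)])
  have hD : q * √(a * b) ≤ (1 - t) * a + t * b := by
    rw [hqdef, ← Real.sqrt_mul hq.le]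
    refine Real.sqrt_le_iff.2 ⟨(hγpos t ht').le, ?_⟩
    nlinarith [sq_nonneg ((1 - t) * a - t * b)]
  have hωt : ω (1 / (1 - ‖x + t • (y - x)‖)) ≤ 1 / q * W := by
    have hpos := (hγpos t ht').trans_le (hγ t ht')
    refine hω.le_mul (by positivity) (by positivity) ?_ ?_
    · rwa [le_div_iff₀ hq0, one_mul]
    · rw [one_div_mul_one_div]
      exact one_div_le_one_div_of_le (by positivity) (hD.trans (hγ t ht'))
  have hbound : |fderiv ℝ f (x + t • (y - x)) (y - x)| ≤ C * (1 / q * W) * ‖x - y‖ := by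
    rw [norm_sub_rev x y, ← Real.norm_eq_abs]
    refine (ContinuousLinearMap.le_opNorm _ _).trans ?_
    exact mul_le_mul_of_nonneg_right ((h _ (hmem t ht')).trans
      (mul_le_mul_of_nonneg_left hωt hC)) (norm_nonneg _)
  have hpi : Real.arcsin (2 * 1 - 1) - Real.arcsin (2 * 0 - 1) = Real.pi := by
    norm_num
  simp only [zero_smul, add_zero, one_smul, add_sub_cancel, hpi] at hmvt
  have h2 : |f x - f y| * (1 / q * 2) ≤ Real.pi * (C * (1 / q * W) * ‖x - y‖) := by
    rw [abs_sub_comm, ← abs_of_pos (show 0 < 1 / q * 2 by positivity), ← abs_mul, ← hmvt, abs_mul,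
      abs_of_pos Real.pi_pos]
    exact mul_le_mul_of_nonneg_left hbound Real.pi_pos.le
  have h3 : |f x - f y| * 2 ≤ C * Real.pi * W * ‖x - y‖ := by
    have := mul_le_mul_of_nonneg_left h2 hq0.le
    field_simp at this
    linarith
  linarith [abs_nonneg (f x - f y)]

/-- In polar coordinates the only singularity is `(1 - t) ^ (-1 / 2)` at `t = 1`, and the radial
factor is at most `1`. -/
theorem integrableOn_one_div_sqrt_one_sub_norm {E : Type*} [NormedAddCommGroup E]
    [NormedSpace ℝ E] [FiniteDimensional ℝ E] [Nontrivial E] [MeasurableSpace E] [BorelSpace E]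
    (μ : Measure E) [μ.IsAddHaarMeasure] :
    IntegrableOn (fun z : E => 1 / √(1 - ‖z‖)) (Metric.ball 0 1) μ := by
  rw [integrableOn_fun_norm_addHaar μ (f := fun t : ℝ => 1 / √(1 - t))]
  have h1 : IntervalIntegrable (fun t : ℝ => t ^ (-(1 / 2) : ℝ)) volume 0 1 :=
    intervalIntegral.intervalIntegrable_rpow' (by norm_num)
  have h2 := (h1.comp_sub_left 1).symm
  simp only [sub_zero, sub_self] at h2
  rw [intervalIntegrable_iff_integrableOn_Ioo_of_le zero_le_one] at h2
  refine Integrable.mono' h2 (Measurable.aestronglyMeasurable (by fun_prop)) ?_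
  refine (ae_restrict_iff' measurableSet_Ioo).2 (Filter.Eventually.of_forall fun t ht => ?_)
  have h3 : 0 < 1 - t := sub_pos.2 ht.2
  have h4 : (1 - t) ^ (-(1 / 2) : ℝ) = 1 / √(1 - t) := by
    rw [Real.rpow_neg h3.le, ← Real.sqrt_eq_rpow, one_div]
  rw [h4, smul_eq_mul, norm_mul, Real.norm_of_nonneg (by positivity : 0 ≤ 1 / √(1 - t)),
    Real.norm_of_nonneg (pow_nonneg ht.1.le _)]
  exact mul_le_of_le_one_left (by positivity) (pow_le_one₀ ht.1.le ht.2.le)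

/-- A weighted Lipschitz bound controls the oscillation on balls. -/
theorem IsMajorant.abs_sub_le_div_sqrt {E : Type*} [NormedAddCommGroup E]
    [NormedSpace ℝ E] {ω : ℝ → ℝ} (hω : IsMajorant ω) {f : E → ℝ} {C : ℝ} (hC : 0 ≤ C)
    {x : E} {r : ℝ} (hr : 0 < r) (hrx : r ≤ 1 - ‖x‖)
    (h : ∀ y, ‖y‖ < 1 → |f x - f y| ≤ C * ω (1 / √((1 - ‖x‖) * (1 - ‖y‖))) * ‖x - y‖)
    {z : E} (hz : ‖z‖ < 1) :
    |f (x + r • z) - f x| ≤ C * r * ω (1 / r) * (1 / √(1 - ‖z‖)) := by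
  have hz0 : 0 < 1 - ‖z‖ := by linarith
  have hrz : ‖r • z‖ = r * ‖z‖ := by rw [norm_smul, Real.norm_of_nonneg hr.le]
  have hy : r * (1 - ‖z‖) ≤ 1 - ‖x + r • z‖ := by
    linarith [norm_add_le x (r • z)]
  have hy0 : 0 < r * (1 - ‖z‖) := by positivity
  have hω0 : 0 ≤ ω (1 / r) := hω.nonneg _ (by positivity)
  have hsq : √(1 - ‖z‖) * r ≤ √((1 - ‖x‖) * (1 - ‖x + r • z‖)) := by
    refine Real.le_sqrt_of_sq_le ?_
    rw [mul_pow, Real.sq_sqrt hz0.le]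
    have := mul_le_mul hrx hy hy0.le (by linarith)
    linarith
  have hs0 : 0 < √(1 - ‖z‖) := Real.sqrt_pos.2 hz0
  have hωz : ω (1 / √((1 - ‖x‖) * (1 - ‖x + r • z‖))) ≤ 1 / √(1 - ‖z‖) * ω (1 / r) := by
    refine hω.le_mul (by positivity) (by positivity) ?_ ?_
    · rw [le_div_iff₀ hs0, one_mul]
      exact Real.sqrt_le_one.2 (by linarith [norm_nonneg z])
    · rw [one_div_mul_one_div]
      exact one_div_le_one_div_of_le (by positivity) hsq
  rw [abs_sub_comm]
  refine (h (x + r • z) (by linarith)).trans ?_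
  rw [sub_add_cancel_left, norm_neg, hrz]
  calc C * ω (1 / √((1 - ‖x‖) * (1 - ‖x + r • z‖))) * (r * ‖z‖)
      ≤ C * (1 / √(1 - ‖z‖) * ω (1 / r)) * (r * 1) := by gcongr
    _ = C * r * ω (1 / r) * (1 / √(1 - ‖z‖)) := by ring

theorem theorem3 (n : ℕ) (hn : 2 ≤ n) (f : EuclideanSpace ℝ (Fin n) → ℝ)
    (hf : ContDiffOn ℝ 1 f (unitBall n))
    (hharm : InnerProductSpace.HarmonicOnNhd f (unitBall n))
    (ω : ℝ → ℝ) (hω : IsMajorant ω) :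
    List.TFAE [
      ∃ C : ℝ, 0 < C ∧ ∀ x ∈ unitBall n, ‖gradient f x‖ ≤ C * ω (1 / bdryDist x),
      ∃ C : ℝ, 0 < C ∧ ∀ x ∈ unitBall n, ∀ y ∈ unitBall n, x ≠ y →
        |f x - f y| / ‖x - y‖ ≤ C * ω (1 / √(bdryDist x * bdryDist y)),
      ∃ C : ℝ, 0 < C ∧ ∀ x ∈ unitBall n, ∀ r : ℝ, 0 < r → r ≤ bdryDist x →
        IntegrableOn (fun ζ => |f ζ - f x|) (Metric.ball x r) volume ∧
        1 / volume.real (Metric.ball x r) * ∫ ζ in Metric.ball x r, |f ζ - f x|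
          ≤ C * r * ω (1 / r)] := by
  have hn0 : n ≠ 0 := by omega
  have : NeZero n := ⟨hn0⟩
  have hd : ∀ x ∈ unitBall n, bdryDist x = 1 - ‖x‖ := fun x hx => bdryDist_eq_one_sub_norm hn0 hx
  have hdiff : DifferentiableOn ℝ f (unitBall n) := hf.differentiableOn one_ne_zero
  have hlip : ∀ {C : ℝ}, (∀ x ∈ unitBall n, ∀ y ∈ unitBall n, x ≠ y →
        |f x - f y| / ‖x - y‖ ≤ C * ω (1 / √(bdryDist x * bdryDist y))) →
      ∀ x ∈ unitBall n, ∀ y, ‖y‖ < 1 →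
        |f x - f y| ≤ C * ω (1 / √((1 - ‖x‖) * (1 - ‖y‖))) * ‖x - y‖ := by
    intro C h x hx y hy
    have hy' : y ∈ unitBall n := mem_ball_zero_iff.2 hy
    rcases eq_or_ne x y with rfl | hxy
    · simp
    · have := h x hx y hy' hxy
      rwa [hd x hx, hd y hy', div_le_iff₀ (norm_pos_iff.2 (sub_ne_zero.2 hxy))] at this
  tfae_have 1 → 2 := by
    rintro ⟨C, hC, h⟩
    refine ⟨C * Real.pi, by positivity, fun x hx y hy hxy => ?_⟩
    rw [div_le_iff₀ (norm_pos_iff.2 (sub_ne_zero.2 hxy)), hd x hx, hd y hy]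
    refine hω.abs_sub_le_of_norm_fderiv_le hdiff hC.le (fun w hw => ?_)
      (mem_ball_zero_iff.1 hx) (mem_ball_zero_iff.1 hy)
    rw [← norm_gradient_eq, ← hd w hw]
    exact h w hw
  tfae_have 2 → 3 := by
    rintro ⟨C, hC, h⟩
    set V := volume.real (Metric.ball (0 : EuclideanSpace ℝ (Fin n)) 1) with hV
    set A := ∫ z in Metric.ball (0 : EuclideanSpace ℝ (Fin n)) 1, 1 / √(1 - ‖z‖) with hA
    have hA0 : 0 ≤ A := integral_nonneg fun z => by positivity
    have hV0 : 0 ≤ V := measureReal_nonneg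
    have hK := integrableOn_one_div_sqrt_one_sub_norm
      (volume : Measure (EuclideanSpace ℝ (Fin n)))
    -- `1 / V * A` is the mean of `1 / √(1 - ‖z‖)`; the added `1` makes positivity immediate.
    refine ⟨C * (1 / V * A + 1), by positivity, fun x hx r hr hrx => ?_⟩
    rw [hd x hx] at hrx
    have hω0 : 0 ≤ ω (1 / r) := hω.nonneg _ (by positivity)
    have hb : ∀ z : EuclideanSpace ℝ (Fin n), ‖z‖ < 1 →
        |f (x + r • z) - f x| ≤ C * r * ω (1 / r) * (1 / √(1 - ‖z‖)) := fun z hz =>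
      hω.abs_sub_le_div_sqrt hC.le hr hrx (hlip h x hx) hz
    have hcont : ContinuousOn (fun z => |f (x + r • z) - f x|)
        (Metric.ball (0 : EuclideanSpace ℝ (Fin n)) 1) := by
      refine ((hdiff.continuousOn.comp (by fun_prop) fun z hz => ?_).sub continuousOn_const).abs
      rw [mem_ball_zero_iff] at hz ⊢
      refine (norm_add_le _ _).trans_lt ?_
      rw [norm_smul, Real.norm_of_nonneg hr.le]
      nlinarith
    have hint : IntegrableOn (fun z => |f (x + r • z) - f x|)
        (Metric.ball (0 : EuclideanSpace ℝ (Fin n)) 1) := by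
      refine Integrable.mono' (hK.const_mul (C * r * ω (1 / r)))
        (hcont.aestronglyMeasurable Metric.isOpen_ball.measurableSet)
        ((ae_restrict_iff' Metric.isOpen_ball.measurableSet).2
          (Filter.Eventually.of_forall fun z hz => ?_))
      rw [Real.norm_eq_abs, abs_abs]
      exact hb z (mem_ball_zero_iff.1 hz)
    refine ⟨(integrableOn_ball_iff_comp_add_smul _ x hr).2 hint, ?_⟩
    rw [average_ball_eq _ x hr]
    have hI : ∫ z in Metric.ball 0 1, |f (x + r • z) - f x| ≤ C * r * ω (1 / r) * A := by
      rw [hA, ← integral_const_mul]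
      exact setIntegral_mono_on hint (hK.const_mul _) Metric.isOpen_ball.measurableSet
        fun z hz => hb z (mem_ball_zero_iff.1 hz)
    calc 1 / V * ∫ z in Metric.ball 0 1, |f (x + r • z) - f x|
        ≤ 1 / V * (C * r * ω (1 / r) * A) := mul_le_mul_of_nonneg_left hI (by positivity)
      _ ≤ C * (1 / V * A + 1) * r * ω (1 / r) := by
        have : 0 ≤ C * r * ω (1 / r) := by positivity
        linarith
  tfae_have 3 → 1 := by
    rintro ⟨C, hC, h⟩
    obtain ⟨K, hK, hest⟩ := exists_norm_fderiv_le_mean_oscillation (E := EuclideanSpace ℝ (Fin n))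
    refine ⟨K * C, by positivity, fun x hx => ?_⟩
    have hx1 : ‖x‖ < 1 := mem_ball_zero_iff.1 hx
    have hr : 0 < bdryDist x := by rw [hd x hx]; linarith
    have hsub : Metric.ball x (bdryDist x) ⊆ unitBall n := fun y hy => by
      rw [mem_ball_iff_norm, hd x hx] at hy
      rw [mem_ball_zero_iff]
      linarith [norm_sub_norm_le y x]
    -- With the largest radius `r = d(x)`, the factors `K / r` and `C * r` leave `K * C`.
    obtain ⟨hint, hle⟩ := h x hx _ hr le_rfl
    rw [norm_gradient_eq]
    refine (hest f x _ hr (fun y hy => hharm y (hsub hy)) hint).trans ?_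
    refine (mul_le_mul_of_nonneg_left hle (by positivity)).trans_eq ?_
    field_simp
  tfae_finish
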